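/- Let $\nu\in\mathbb R\setminus\{0\}$, let $U\subset\mathbb R^n$ be open and convex with $U\subset\{|x|<\tfrac1{2|\nu|}\}$, and let $$F(x,y)=\frac{\sqrt{|y|^2-4\nu^2\left(|x|^2|y|^2-\langle x,y\rangle^2\right)}}{1-4\nu^2|x|^2}-\frac{2\nu\langle x,y\rangle}{1-4\nu^2|x|^2},\qquad x\in U,\ y\in\mathbb R^n.$$ Sprays $S,\overline S$ on $T_0U=\{(x,y):x\in U,\ y\neq0\}$ are projectively related with projective factor $P$ if $P$ is smooth and positively $1$-homogeneous in $y$ on $T_0U$ and $\overline S=S-2P\mathcal C$, where $\mathcal C=y^i\frac{\partial}{\partial y^i}$; Finsler functions are projectively related if their geodesic sprays are. A smooth positively $1$-homogeneous $P$ is a Hamel function for $S$ if $S\left(\frac{\partial P}{\partial y^i}\right)-\frac{\partial P}{\partial x^i}=0$ for all $i$. A Finsler function is projectively flat with projective factor $P$ if its geodesic spray is $S_0-2P\mathcal C$, where $S_0=y^i\frac{\partial}{\partial x^i}$. It has constant flag curvature $\kappa$ if the Jacobi endomorphism of its geodesic spray is $\Phi=\kappa F^2J-\kappa F\,d_JF\otimes\mathcal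 C$, where $J=dx^i\otimes\frac{\partial}{\partial y^i}$ and $d_JF=\frac{\partial F}{\partial y^i}dx^i$. 1. $F$ is a Finsler function on $U$, projectively flat with projective factor $-\nu F$, and of constant flag curvature $-\nu^2$. 2. Let $e\in\mathbb R^n$ and $f\in\mathbb R$ be such that $\langle e,x\rangle+f\neq0$ on $U$, put $$\overline b(x,y)=-\frac{\langle e,y\rangle}{2\nu\left(\langle e,x\rangle+f\right)},$$ and suppose that $\overline F=F+\overline b$ is positive on $T_0U$. Then $\overline F$ is a Finsler function on $U$. It is projectively related to $F$ with projective factor $P=\nu\overline b$ (so $\overline S=S-2\nu\overline b\,\mathcal C$ for the geodesic sprays $S$ of $F$ and $\overline S$ of $\overline F$). The factor $P$, which is linear in $y$, is a Hamel function for $S$. The metric $\overline F$ is projectively flat, with projective factor $-\nu(F-\overline b)$, and has the same constant flag curvature $-\nu^2$ as $F$. 3. Conversely, let $\beta(x,y)=\beta_i(x)y^i$ be given by a smooth $1$-form on $U$ that is not identically zero, and suppose that $F+\beta$ is a Finsler function on $U$ which is projectively related to $F$ with projective factor $\mu\beta$ for some $\mu\in\mathbb R$. Then $\mu=\nu$,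 and there are $e\in\mathbb R^n$, $f\in\mathbb R$ with $\langle e,x\rangle+f\neq0$ and $\beta(x,y)=-\dfrac{\langle e,y\rangle}{2\nu(\langle e,x\rangle+f)}$ for all $x\in U$, $y\in\mathbb R^n$. 4. Let $\nu=-\tfrac12$, $f=1$, $e\in\mathbb R^n$ with $|e|<1$. Then $1+\langle e,x\rangle\ne0$ on the unit ball $B^n$; on $B^n$ the metric $F$ is the Funk metric $$\frac{\sqrt{|y|^2-(|x|^2|y|^2-\langle x,y\rangle^2)}}{1-|x|^2}+\frac{\langle x,y\rangle}{1-|x|^2},$$ and $\overline F$ is the generalized Funk metric, namely the Funk metric plus $\dfrac{\langle e,y\rangle}{1+\langle e,x\rangle}$; the generalized Funk metric is a Finsler function on $B^n$ of constant flag curvature $-\tfrac14$. -/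

import Mathlib

open Set Metric
open scoped ContDiff

noncomputable section

namespace FinslerDeform

/-! Geometric objects on an open set `U` of a normed space `E`. A point of the tangent bundle
`TU = U × E` is a pair `z = (x, y)`; a tangent vector at such a point is again a pair `(ξ, η)`,
with `ξ` the `x`-part and `η` the `y`-part. -/

section General

variable {E : Type*} [NormedAddCommGroup E] [NormedSpace ℝ E]

/-- The slit tangent bundle `T₀U`: the tangent bundle without its zero section. -/
def slit (U : Set E) : Set (E × E) := {z | z.1 ∈ U ∧ z.2 ≠ 0}

/-- The Liouville vector field `𝒞 = yⁱ ∂/∂yⁱ`. -/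
def liouville (z : E × E) : E × E := (0, z.2)

/-- The flat spray `S₀ = yⁱ ∂/∂xⁱ`. -/
def flatSpray (z : E × E) : E × E := (z.2, 0)

/-- Smooth, positively 1-homogeneous functions on `T₀U`. -/
def IsHomogeneousOne (U : Set E) (P : E × E → ℝ) : Prop :=
  ContDiffOn ℝ ∞ P (slit U) ∧
    ∀ x ∈ U, ∀ y : E, y ≠ 0 → ∀ t : ℝ, 0 < t → P (x, t • y) = t * P (x, y)

/-- The metric tensor `g(ξ, η) = ½ ξⁱ ηʲ ∂²F² / ∂yⁱ∂yʲ` at the point `z`. -/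
def metricTensor (F : E × E → ℝ) (z : E × E) (ξ η : E) : ℝ :=
  (1 / 2) * fderiv ℝ (fun w => fderiv ℝ (fun u => F u ^ 2) w (0, ξ)) z (0, η)

/-- Finsler functions on `U`: continuous on `TU`, smooth and positive on `T₀U`, positively
1-homogeneous, and with nondegenerate metric tensor on `T₀U`. -/
structure IsFinsler (U : Set E) (F : E × E → ℝ) : Prop where
  continuousOn : ContinuousOn F (U ×ˢ (univ : Set E))
  smooth : ContDiffOn ℝ ∞ F (slit U)
  pos : ∀ z ∈ slit U, 0 < F z
  homogeneous : ∀ x ∈ U, ∀ y : E, ∀ t : ℝ, 0 < t → F (x, t • y) = t * F (x, y)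
  nondegenerate : ∀ z ∈ slit U, ∀ ξ : E, (∀ η : E, metricTensor F z ξ η = 0) → ξ = 0

/-- Sprays on `U`: smooth vector fields `S = yⁱ ∂/∂xⁱ - 2 Gⁱ ∂/∂yⁱ` on `T₀U` whose coefficients
`Gⁱ` are positively 2-homogeneous in `y` (that is, `J S = 𝒞` and `[𝒞, S] = S`). -/
structure IsSpray (U : Set E) (S : E × E → E × E) : Prop where
  smooth : ContDiffOn ℝ ∞ S (slit U)
  fst_eq : ∀ z ∈ slit U, (S z).1 = z.2
  homogeneous : ∀ x ∈ U, ∀ y : E, y ≠ 0 → ∀ t : ℝ, 0 < t →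
    (S (x, t • y)).2 = t ^ 2 • (S (x, y)).2

/-- The semi-basic 1-form `d_J L = (∂L/∂yⁱ) dxⁱ`. -/
def dJ (L : E × E → ℝ) (z : E × E) : E × E →L[ℝ] ℝ :=
  (fderiv ℝ L z).comp ((ContinuousLinearMap.inr ℝ E E).comp (ContinuousLinearMap.fst ℝ E E))

/-- The exterior derivative of a 1-form: `dθ(u, v) = (D_u θ)(v) - (D_v θ)(u)`. -/
def extDerivOne (θ : E × E → (E × E →L[ℝ] ℝ)) (z u v : E × E) : ℝ :=
  fderiv ℝ θ z u v - fderiv ℝ θ z v u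

/-- `S` is the geodesic spray of `F` on `U`: `i_S d d_J F² = - d F²` on `T₀U`. For a Finsler
function `F` this determines `S` on `T₀U`. -/
def IsGeodesicSpray (U : Set E) (F : E × E → ℝ) (S : E × E → E × E) : Prop :=
  IsSpray U S ∧ ∀ z ∈ slit U, ∀ v : E × E,
    extDerivOne (dJ fun u => F u ^ 2) z (S z) v = - fderiv ℝ (fun u => F u ^ 2) z v

/-- The sprays `S` and `S'` are projectively related on `U` with projective factor `P`, a smooth
1-homogeneous function on `T₀U`: `S' = S - 2 P 𝒞`. -/
def SpraysProjRelated (U : Set E) (S S' : E × E → E × E) (P : E × E → ℝ) : Prop :=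
  IsHomogeneousOne U P ∧ ∀ z ∈ slit U, S' z = S z - (2 * P z) • liouville z

/-- The Finsler functions `F` and `F'` are projectively related on `U`, their geodesic sprays
satisfying `S' = S - 2 P 𝒞`. -/
def ProjRelated (U : Set E) (F F' P : E × E → ℝ) : Prop :=
  ∃ S S' : E × E → E × E,
    IsGeodesicSpray U F S ∧ IsGeodesicSpray U F' S' ∧ SpraysProjRelated U S S' P

/-- `F` is projectively flat on `U` with projective factor `P`: its geodesic spray is
`S₀ - 2 P 𝒞`. -/
def ProjFlat (U : Set E) (F P : E × E → ℝ) : Prop :=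
  ∃ S : E × E → E × E, IsGeodesicSpray U F S ∧ SpraysProjRelated U flatSpray S P

/-- The Euler-Lagrange 1-form `δ_S L = {S(∂L/∂yⁱ) - ∂L/∂xⁱ} dxⁱ`, evaluated on `ξ`. -/
def eulerLagrange (S : E × E → E × E) (L : E × E → ℝ) (z : E × E) (ξ : E) : ℝ :=
  fderiv ℝ (fun w => fderiv ℝ L w (0, ξ)) z (S z) - fderiv ℝ L z (ξ, 0)

/-- Hamel functions for the spray `S`: 1-homogeneous functions `P` with `δ_S P = 0`. -/
def IsHamel (U : Set E) (S : E × E → E × E) (P : E × E → ℝ) : Prop :=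
  IsHomogeneousOne U P ∧ ∀ z ∈ slit U, ∀ ξ : E, eulerLagrange S P z ξ = 0

/-- The coefficients `Gⁱ` of the spray `S = yⁱ ∂/∂xⁱ - 2 Gⁱ ∂/∂yⁱ`. -/
def sprayCoeff (S : E × E → E × E) (z : E × E) : E := (-(1 / 2) : ℝ) • (S z).2

/-- The nonlinear connection `Nⁱⱼ = ∂Gⁱ/∂yʲ`. -/
def nonlinConn (S : E × E → E × E) (z : E × E) : E →L[ℝ] E :=
  (fderiv ℝ (sprayCoeff S) z).comp (ContinuousLinearMap.inr ℝ E E)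

/-- The Jacobi endomorphism `Rⁱⱼ = 2 δGⁱ/δxʲ - S(Nⁱⱼ) + Nⁱₖ Nᵏⱼ`, where
`δ/δxʲ = ∂/∂xʲ - Nᵏⱼ ∂/∂yᵏ`; the vector `ξ` is sent to `Rⁱⱼ ξʲ`. -/
def jacobiEndo (S : E × E → E × E) (z : E × E) (ξ : E) : E :=
  (2 : ℝ) • fderiv ℝ (sprayCoeff S) z (ξ, - nonlinConn S z ξ)
    - fderiv ℝ (nonlinConn S) z (S z) ξ + nonlinConn S z (nonlinConn S z ξ)

/-- `F` has constant flag curvature `κ` on `U`: the Jacobi endomorphism of its geodesic spray is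
`Φ = κ F² J - κ F d_J F ⊗ 𝒞`. -/
def HasConstFlagCurv (U : Set E) (F : E × E → ℝ) (κ : ℝ) : Prop :=
  ∃ S : E × E → E × E, IsGeodesicSpray U F S ∧ ∀ z ∈ slit U, ∀ ξ : E,
    jacobiEndo S z ξ = (κ * F z ^ 2) • ξ - (κ * F z * fderiv ℝ F z (0, ξ)) • z.2

/-- A 1-form `β` on `U`, seen as the function `βᵢ(x) yⁱ`, linear in the fibre, on `TU`. -/
def ofForm (β : E → (E →L[ℝ] ℝ)) (z : E × E) : ℝ := β z.1 z.2

/-- The Randers deformation `F + β` of `F` by the 1-form `β`. -/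
def randersDeform (F : E × E → ℝ) (β : E → (E →L[ℝ] ℝ)) (z : E × E) : ℝ := F z + ofForm β z

end General

section Families

variable {n : ℕ}

/-- The Riemannian part `a`. -/
def aPart (c : ℝ) (z : EuclideanSpace ℝ (Fin n) × EuclideanSpace ℝ (Fin n)) : ℝ :=
  Real.sqrt (‖z.2‖ ^ 2 - 4 * c ^ 2 * (‖z.1‖ ^ 2 * ‖z.2‖ ^ 2 - (inner ℝ z.1 z.2) ^ 2))
    / (1 - 4 * c ^ 2 * ‖z.1‖ ^ 2)

/-- The linear part `b`. -/
def bPart (c : ℝ) (z : EuclideanSpace ℝ (Fin n) × EuclideanSpace ℝ (Fin n)) : ℝ :=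
  2 * c * inner ℝ z.1 z.2 / (1 - 4 * c ^ 2 * ‖z.1‖ ^ 2)

/-- The projectively flat Randers metric `F = a + b` with parameter `c`. -/
def randers (c : ℝ) (z : EuclideanSpace ℝ (Fin n) × EuclideanSpace ℝ (Fin n)) : ℝ :=
  aPart c z + bPart c z

/-- The 1-form `b̄ = -⟨e, y⟩ / (2 ν (⟨e, x⟩ + f))`. -/
def bBar (ν : ℝ) (e : EuclideanSpace ℝ (Fin n)) (f : ℝ) (x : EuclideanSpace ℝ (Fin n)) :
    EuclideanSpace ℝ (Fin n) →L[ℝ] ℝ :=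
  (-(1 / (2 * ν * (inner ℝ e x + f)))) • innerSL ℝ e

/-- The Funk metric of the unit ball. -/
def funk (z : EuclideanSpace ℝ (Fin n) × EuclideanSpace ℝ (Fin n)) : ℝ :=
  Real.sqrt (‖z.2‖ ^ 2 - (‖z.1‖ ^ 2 * ‖z.2‖ ^ 2 - (inner ℝ z.1 z.2) ^ 2)) / (1 - ‖z.1‖ ^ 2)
    + inner ℝ z.1 z.2 / (1 - ‖z.1‖ ^ 2)

/-- The generalized Funk metric of the unit ball. -/
def genFunk (e : EuclideanSpace ℝ (Fin n))
    (z : EuclideanSpace ℝ (Fin n) × EuclideanSpace ℝ (Fin n)) : ℝ :=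
  funk z + inner ℝ e z.2 / (1 + inner ℝ e z.1)

end Families

end FinslerDeform

end

open FinslerDeform

open Set Metric
open scoped ContDiff
open FinslerDeform

namespace FinslerDeform

/-! ### The slit tangent bundle as an open set -/

section Slit

variable {E : Type*} [NormedAddCommGroup E] {U : Set E} {z : E × E}

/-! Everything reduces to the Funk equation `∂G/∂xⁱ = 2 c G ∂G/∂yⁱ` (`IsFunk`). With `c = -ν`, the
metric `F` is the positive root of `F = ‖y + 2 c F x‖`, and implicit differentiation yields the Funk
equation with constant `c` (`IsFunkRoot.isFunk`). The form `b̄` satisfies `∂ᵢb̄ⱼ = 2 ν b̄ᵢ b̄ⱼ`,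
hence the Funk equation with constant `-c`.

Each solution is a Hamel function for the flat spray, and so is the sum `F + b̄`. Moreover `S₀(F +
b̄) = 2c(F² - b̄²)`, so the geodesic spray of `F + b̄` is `S₀ - 2P𝒞` with `P = c(F - b̄)`. The
identity `∂P/∂xⁱ - P ∂P/∂yⁱ = c²(F + b̄) ∂(F + b̄)/∂yⁱ` then gives curvature `-c²` by
`jacobiEndo_sprayOf`. Nondegeneracy holds because the fibre Hessian of `F` is semidefinite with
kernel spanned by `y`, and a linear term does not change it.

Conversely, comparing the energy identity of `F + β` at `y` and `-y` forces `μ = ν`. The energy and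
Hamel identities then give `∂ᵢβⱼ = 2 ν βᵢ βⱼ`, which is integrated along segments of the convex set
`U`. -/

theorem isOpen_slit (hU : IsOpen U) : IsOpen (slit U) := by
  have h : slit U = U ×ˢ ({0}ᶜ : Set E) := by
    ext z; simp [slit]
  rw [h]
  exact hU.prod isOpen_compl_singleton

theorem slit_mem_nhds (hU : IsOpen U) (hz : z ∈ slit U) : slit U ∈ nhds z :=
  (isOpen_slit hU).mem_nhds hz

end Slit

/-! ### Euler identities, geodesic sprays of the form `S₀ - 2Q𝒞`, and their curvature -/

section SlitCalculus

variable {E : Type*} [NormedAddCommGroup E] [NormedSpace ℝ E] {U : Set E}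
  {F P Q b : E × E → ℝ} {z : E × E}

theorem contDiffAt_of_slit (hU : IsOpen U) (hF : ContDiffOn ℝ ∞ F (slit U)) (hz : z ∈ slit U) :
    ContDiffAt ℝ ∞ F z :=
  hF.contDiffAt (slit_mem_nhds hU hz)

theorem differentiableAt_of_slit (hU : IsOpen U) (hF : ContDiffOn ℝ ∞ F (slit U))
    (hz : z ∈ slit U) : DifferentiableAt ℝ F z :=
  (contDiffAt_of_slit hU hF hz).differentiableAt (by simp)

theorem differentiableAt_fderiv_of_slit (hU : IsOpen U) (hF : ContDiffOn ℝ ∞ F (slit U))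
    (hz : z ∈ slit U) : DifferentiableAt ℝ (fderiv ℝ F) z :=
  ((contDiffAt_of_slit hU hF hz).fderiv_right (m := 1) (by norm_cast)).differentiableAt (by simp)

theorem fderiv_congr_slit (hU : IsOpen U) {V : Type*} [NormedAddCommGroup V] [NormedSpace ℝ V]
    {f g : E × E → V} (h : ∀ w ∈ slit U, f w = g w) (hz : z ∈ slit U) :
    fderiv ℝ f z = fderiv ℝ g z :=
  Filter.EventuallyEq.fderiv_eq (Filter.mem_of_superset (slit_mem_nhds hU hz) h)

theorem fderiv_fderiv_apply (hU : IsOpen U) (hF : ContDiffOn ℝ ∞ F (slit U))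
    (hz : z ∈ slit U) (u v : E × E) :
    fderiv ℝ (fun w => fderiv ℝ F w u) z v = fderiv ℝ (fderiv ℝ F) z v u := by
  rw [fderiv_clm_apply (differentiableAt_fderiv_of_slit hU hF hz) (differentiableAt_const u)]
  simp

theorem fderiv_fderiv_symm (hU : IsOpen U) (hF : ContDiffOn ℝ ∞ F (slit U))
    (hz : z ∈ slit U) (u v : E × E) :
    fderiv ℝ (fderiv ℝ F) z u v = fderiv ℝ (fderiv ℝ F) z v u :=
  ((contDiffAt_of_slit hU hF hz).isSymmSndFDerivAt (by simp; norm_cast)) u v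

theorem fderiv_sq (hU : IsOpen U) (hF : ContDiffOn ℝ ∞ F (slit U)) (hz : z ∈ slit U) :
    fderiv ℝ (fun u => F u ^ 2) z = (2 * F z) • fderiv ℝ F z := by
  rw [fderiv_fun_pow _ (differentiableAt_of_slit hU hF hz)]
  simp

theorem fderiv_fderiv_sq (hU : IsOpen U) (hF : ContDiffOn ℝ ∞ F (slit U)) (hz : z ∈ slit U)
    (u v : E × E) :
    fderiv ℝ (fderiv ℝ (fun u => F u ^ 2)) z u v =
      2 * (fderiv ℝ F z u * fderiv ℝ F z v + F z * fderiv ℝ (fderiv ℝ F) z u v) := by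
  have hd := differentiableAt_of_slit hU hF hz
  rw [fderiv_congr_slit hU (fun w hw => fderiv_sq hU hF hw) hz,
    fderiv_fun_smul (hd.const_mul 2) (differentiableAt_fderiv_of_slit hU hF hz),
    fderiv_const_mul hd]
  simp
  ring

theorem metricTensor_eq (hU : IsOpen U) (hF : ContDiffOn ℝ ∞ F (slit U)) (hz : z ∈ slit U)
    (ξ η : E) :
    metricTensor F z ξ η = fderiv ℝ F z (0, η) * fderiv ℝ F z (0, ξ)
      + F z * fderiv ℝ (fderiv ℝ F) z (0, η) (0, ξ) := by
  rw [metricTensor, fderiv_fderiv_apply hU (hF.pow 2) hz, fderiv_fderiv_sq hU hF hz]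
  ring

/-- Euler's theorem. -/
theorem IsHomogeneousOne.fderiv_vertical (hU : IsOpen U) (hF : IsHomogeneousOne U F)
    (hz : z ∈ slit U) : fderiv ℝ F z (0, z.2) = F z := by
  have hd := (differentiableAt_of_slit hU hF.1 hz).hasFDerivAt
  have hz' : z = (z.1, (1 : ℝ) • z.2) := by simp
  have hc : HasDerivAt (fun t : ℝ => (z.1, t • z.2)) (0, z.2) 1 := by
    have := (hasDerivAt_const (1 : ℝ) z.1).prodMk ((hasDerivAt_id (1 : ℝ)).smul_const z.2)
    simpa using this
  have h1 : HasDerivAt (fun t : ℝ => F (z.1, t • z.2)) (fderiv ℝ F z (0, z.2)) 1 := by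
    have hd' : HasFDerivAt F (fderiv ℝ F z) ((fun t : ℝ => (z.1, t • z.2)) 1) := by
      simpa using hd
    exact hd'.comp_hasDerivAt 1 hc
  have h2 : HasDerivAt (fun t : ℝ => t * F z) (F z) 1 := by
    simpa using (hasDerivAt_id (1 : ℝ)).mul_const (F z)
  refine h1.unique (h2.congr_of_eventuallyEq ?_)
  filter_upwards [lt_mem_nhds (zero_lt_one' ℝ)] with t ht
  exact hF.2 z.1 hz.1 z.2 hz.2 t ht

theorem fderiv_apply_moving {A B : E × E → E} {A' B' : E × E →L[ℝ] E} (hU : IsOpen U)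
    (hF : ContDiffOn ℝ ∞ F (slit U)) (hz : z ∈ slit U)
    (hA : HasFDerivAt A A' z) (hB : HasFDerivAt B B' z) (v : E × E) :
    fderiv ℝ (fun w => fderiv ℝ F w (A w, B w)) z v =
      fderiv ℝ (fderiv ℝ F) z v (A z, B z) + fderiv ℝ F z (A' v, B' v) := by
  have h := (differentiableAt_fderiv_of_slit hU hF hz).hasFDerivAt.clm_apply (hA.prodMk hB)
  rw [h.fderiv]
  simp [add_comm]

/-- Euler's identity, differentiated in the direction `v`; the `y`-part of `v` cancels. -/
theorem IsHomogeneousOne.fderiv_fderiv_vertical (hU : IsOpen U) (hF : IsHomogeneousOne U F)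
    (hz : z ∈ slit U) (v : E × E) :
    fderiv ℝ (fderiv ℝ F) z v (0, z.2) = fderiv ℝ F z (v.1, 0) := by
  have h := fderiv_apply_moving hU hF.1 hz (hasFDerivAt_const (0 : E) z)
    (hasFDerivAt_snd (𝕜 := ℝ) (p := z)) v
  rw [fderiv_congr_slit hU (fun w hw => hF.fderiv_vertical hU hw) hz] at h
  have hv : v = (v.1, 0) + (0, v.2) := by simp
  have h2 : fderiv ℝ F z v = fderiv ℝ F z (v.1, 0) + fderiv ℝ F z (0, v.2) := by
    rw [← map_add, ← hv]
  simp at h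
  linarith

theorem IsHomogeneousOne.fderiv_fderiv_vertical_vertical (hU : IsOpen U)
    (hF : IsHomogeneousOne U F) (hz : z ∈ slit U) (ξ : E) :
    fderiv ℝ (fderiv ℝ F) z (0, z.2) (0, ξ) = 0 := by
  rw [fderiv_fderiv_symm hU hF.1 hz, hF.fderiv_fderiv_vertical hU hz]
  exact map_zero _

/-- The value of the flat spray on `F`, differentiated along the fibre. -/
theorem fderiv_flat_vertical (hU : IsOpen U) (hF : ContDiffOn ℝ ∞ F (slit U)) (hz : z ∈ slit U)
    (ξ : E) :
    fderiv ℝ (fun w => fderiv ℝ F w (w.2, 0)) z (0, ξ) =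
      fderiv ℝ (fderiv ℝ F) z (z.2, 0) (0, ξ) + fderiv ℝ F z (ξ, 0) := by
  have h := fderiv_apply_moving hU hF hz (hasFDerivAt_snd (𝕜 := ℝ) (p := z))
    (hasFDerivAt_const (0 : E) z) (0, ξ)
  rw [h, fderiv_fderiv_symm hU hF hz]
  simp

theorem extDerivOne_dJ (hU : IsOpen U) (hF : ContDiffOn ℝ ∞ F (slit U)) (hz : z ∈ slit U)
    (u v : E × E) :
    extDerivOne (dJ F) z u v =
      fderiv ℝ (fderiv ℝ F) z u (0, v.1) - fderiv ℝ (fderiv ℝ F) z v (0, u.1) := by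
  have h : HasFDerivAt (dJ F) _ z :=
    (differentiableAt_fderiv_of_slit hU hF hz).hasFDerivAt.clm_comp
      (hasFDerivAt_const
        ((ContinuousLinearMap.inr ℝ E E).comp (ContinuousLinearMap.fst ℝ E E)) z)
  rw [extDerivOne, h.fderiv]
  simp

/-- The field `S₀ - 2 Q 𝒞`. -/
def sprayOf (Q : E × E → ℝ) (z : E × E) : E × E := flatSpray z - (2 * Q z) • liouville z

theorem sprayOf_eq (Q : E × E → ℝ) (z : E × E) :
    sprayOf Q z = (z.2, 0) - (2 * Q z) • ((0, z.2) : E × E) := rfl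

theorem isSpray_sprayOf (hQ : IsHomogeneousOne U Q) : IsSpray U (sprayOf Q) where
  smooth := by
    unfold sprayOf flatSpray liouville
    exact ContDiffOn.sub (by fun_prop)
      ((contDiffOn_const.mul hQ.1).smul (by fun_prop))
  fst_eq z _ := by simp [sprayOf_eq]
  homogeneous x hx y hy t ht := by
    simp only [sprayOf_eq, hQ.2 x hx y hy t ht]
    simp [smul_smul]
    ring_nf

/-- By homogeneity the defect in the geodesic equation is semi-basic and splits into an energy term
and a Hamel term. Only the value of the factor at `z` enters, so `q` is a plain number. -/
theorem geodesic_defect (hU : IsOpen U) (hF : IsHomogeneousOne U F) (hz : z ∈ slit U) (q : ℝ)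
    (v : E × E) :
    extDerivOne (dJ fun u => F u ^ 2) z ((z.2, 0) - (2 * q) • ((0, z.2) : E × E)) v
        + fderiv ℝ (fun u => F u ^ 2) z v =
      2 * ((fderiv ℝ F z (z.2, 0) - 2 * q * F z) * fderiv ℝ F z (0, v.1)
        + F z * (fderiv ℝ (fderiv ℝ F) z (z.2, 0) (0, v.1) - fderiv ℝ F z (v.1, 0))) := by
  rw [extDerivOne_dJ hU (hF.1.pow 2) hz, fderiv_fderiv_sq hU hF.1 hz,
    fderiv_fderiv_sq hU hF.1 hz, fderiv_sq hU hF.1 hz]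
  simp only [map_sub, map_smul, sub_apply, smul_apply,
    smul_eq_mul, Prod.fst_sub, Prod.smul_fst, smul_zero, sub_zero,
    hF.fderiv_vertical hU hz, hF.fderiv_fderiv_vertical hU hz,
    hF.fderiv_fderiv_vertical_vertical hU hz]
  ring

theorem isGeodesicSpray_sprayOf (hU : IsOpen U) (hF : IsHomogeneousOne U F)
    (hQ : IsHomogeneousOne U Q)
    (henergy : ∀ z ∈ slit U, fderiv ℝ F z (z.2, 0) = 2 * Q z * F z)
    (hhamel : ∀ z ∈ slit U, ∀ ξ : E,
      fderiv ℝ (fderiv ℝ F) z (z.2, 0) (0, ξ) = fderiv ℝ F z (ξ, 0)) :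
    IsGeodesicSpray U F (sprayOf Q) := by
  refine ⟨isSpray_sprayOf hQ, fun z hz v => ?_⟩
  have h := geodesic_defect hU hF hz (Q z) v
  rw [henergy z hz, hhamel z hz] at h
  rw [sprayOf_eq]
  linarith

theorem energy_of_isGeodesicSpray (hU : IsOpen U) (hF : IsHomogeneousOne U F)
    (hpos : ∀ z ∈ slit U, 0 < F z) {S : E × E → E × E} (hS : IsGeodesicSpray U F S)
    (hSQ : ∀ z ∈ slit U, S z = sprayOf Q z) (hz : z ∈ slit U) :
    fderiv ℝ F z (z.2, 0) = 2 * Q z * F z := by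
  -- Testing on `y` itself kills the Hamel term, by Euler's identities, and isolates the energy
  -- term.
  have h := geodesic_defect hU hF hz (Q z) (z.2, 0)
  have hg := hS.2 z hz (z.2, 0)
  rw [hSQ z hz, sprayOf_eq] at hg
  simp only [hF.fderiv_vertical hU hz, hF.fderiv_fderiv_vertical hU hz, sub_self] at h
  have hp := hpos z hz
  have h0 : (fderiv ℝ F z (z.2, 0) - 2 * Q z * F z) * F z = 0 := by linarith
  rcases mul_eq_zero.1 h0 with h1 | h1 <;> linarith

theorem hamel_of_isGeodesicSpray (hU : IsOpen U) (hF : IsHomogeneousOne U F)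
    (hpos : ∀ z ∈ slit U, 0 < F z) {S : E × E → E × E} (hS : IsGeodesicSpray U F S)
    (hSQ : ∀ z ∈ slit U, S z = sprayOf Q z) (hz : z ∈ slit U) (ξ : E) :
    fderiv ℝ (fderiv ℝ F) z (z.2, 0) (0, ξ) = fderiv ℝ F z (ξ, 0) := by
  have h := geodesic_defect hU hF hz (Q z) (ξ, 0)
  have hg := hS.2 z hz (ξ, 0)
  rw [hSQ z hz, sprayOf_eq] at hg
  rw [energy_of_isGeodesicSpray hU hF hpos hS hSQ hz] at h
  have hp := hpos z hz
  have h0 : F z * (fderiv ℝ (fderiv ℝ F) z (z.2, 0) (0, ξ) - fderiv ℝ F z (ξ, 0)) = 0 := by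
    simp only at h
    linarith
  rcases mul_eq_zero.1 h0 with h1 | h1 <;> linarith

theorem IsFinsler.isHomogeneousOne (hF : IsFinsler U F) : IsHomogeneousOne U F :=
  ⟨hF.smooth, fun x hx y _ t ht => hF.homogeneous x hx y t ht⟩

/-- Two geodesic sprays differ by a vertical vector, and contracting `d d_J F²` with a vertical
vector gives twice the metric tensor, which is nondegenerate. -/
theorem IsFinsler.geodesicSpray_unique (hU : IsOpen U) (hF : IsFinsler U F)
    {S S' : E × E → E × E} (hS : IsGeodesicSpray U F S) (hS' : IsGeodesicSpray U F S')
    (hz : z ∈ slit U) : S z = S' z := by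
  have hfst : (S z).1 = (S' z).1 := by rw [hS.1.fst_eq z hz, hS'.1.fst_eq z hz]
  refine Prod.ext hfst (sub_eq_zero.1 (hF.nondegenerate z hz _ fun η => ?_))
  have h1 := hS.2 z hz (η, 0)
  have h2 := hS'.2 z hz (η, 0)
  rw [extDerivOne_dJ hU (hF.smooth.pow 2) hz] at h1 h2
  have h3 : fderiv ℝ (fderiv ℝ fun u => F u ^ 2) z (S z - S' z) (0, η) = 0 := by
    rw [map_sub, sub_apply]
    rw [hfst] at h1
    simp only at h1 h2
    linarith
  have h4 : S z - S' z = (0, (S z).2 - (S' z).2) := by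
    ext <;> simp [hfst]
  rw [metricTensor, fderiv_fderiv_apply hU (hF.smooth.pow 2) hz,
    fderiv_fderiv_symm hU (hF.smooth.pow 2) hz, ← h4, h3, mul_zero]

/-- The Hamel condition is a projective invariant: the term along `𝒞` drops out since `yʲ ∂²P/∂yʲ∂yⁱ
= 0`. -/
theorem isHamel_of_flat (hU : IsOpen U) (hP : IsHomogeneousOne U P)
    (hhamel : ∀ z ∈ slit U, ∀ ξ : E,
      fderiv ℝ (fderiv ℝ P) z (z.2, 0) (0, ξ) = fderiv ℝ P z (ξ, 0))
    {S : E × E → E × E} (hSQ : ∀ z ∈ slit U, S z = sprayOf Q z) : IsHamel U S P := by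
  refine ⟨hP, fun z hz ξ => ?_⟩
  rw [eulerLagrange, fderiv_fderiv_apply hU hP.1 hz, hSQ z hz, sprayOf_eq]
  simp only [map_sub, map_smul, sub_apply, smul_apply,
    hP.fderiv_fderiv_vertical_vertical hU hz, hhamel z hz, smul_zero, sub_zero, sub_self]

theorem nonlinConn_sprayOf (hU : IsOpen U) (hP : IsHomogeneousOne U P) (hz : z ∈ slit U) :
    nonlinConn (sprayOf P) z = P z • ContinuousLinearMap.id ℝ E
      + ((fderiv ℝ P z).comp (ContinuousLinearMap.inr ℝ E E)).smulRight z.2 := by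
  have h : sprayCoeff (sprayOf P) = fun w => P w • w.2 := by
    ext w
    simp [sprayCoeff, sprayOf_eq, smul_smul]
  have h2 := (differentiableAt_of_slit hU hP.1 hz).hasFDerivAt.smul
    (hasFDerivAt_snd (𝕜 := ℝ) (p := z))
  rw [nonlinConn, h]
  erw [h2.fderiv]
  ext v
  simp

theorem fderiv_sprayCoeff_sprayOf (hU : IsOpen U) (hP : IsHomogeneousOne U P) (hz : z ∈ slit U)
    (v : E × E) :
    fderiv ℝ (sprayCoeff (sprayOf P)) z v = P z • v.2 + fderiv ℝ P z v • z.2 := by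
  have h : sprayCoeff (sprayOf P) = fun w => P w • w.2 := by
    ext w
    simp [sprayCoeff, sprayOf_eq, smul_smul]
  have h2 := (differentiableAt_of_slit hU hP.1 hz).hasFDerivAt.smul
    (hasFDerivAt_snd (𝕜 := ℝ) (p := z))
  rw [h]
  erw [h2.fderiv]
  simp

theorem fderiv_nonlinConn_sprayOf (hU : IsOpen U) (hP : IsHomogeneousOne U P) (hz : z ∈ slit U)
    (v : E × E) (ξ : E) :
    fderiv ℝ (nonlinConn (sprayOf P)) z v ξ = fderiv ℝ P z v • ξ
      + (fderiv ℝ (fderiv ℝ P) z v (0, ξ) • z.2 + fderiv ℝ P z (0, ξ) • v.2) := by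
  have hd := differentiableAt_of_slit hU hP.1 hz
  have hd2 := differentiableAt_fderiv_of_slit hU hP.1 hz
  have hN : DifferentiableAt ℝ (nonlinConn (sprayOf P)) z := by
    have : DifferentiableAt ℝ (fun w : E × E => P w • ContinuousLinearMap.id ℝ E
      + ((fderiv ℝ P w).comp (ContinuousLinearMap.inr ℝ E E)).smulRight w.2) z := by
      have h1 : DifferentiableAt ℝ (fun w : E × E =>
          (fderiv ℝ P w).comp (ContinuousLinearMap.inr ℝ E E)) z :=
        hd2.clm_comp (differentiableAt_const _)
      -- Writing the rank-one term through the bilinear map `smulRightL` exposes it as an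
      -- application of differentiable maps.
      have h2 : DifferentiableAt ℝ (fun w : E × E =>
          ContinuousLinearMap.smulRightL ℝ E E
            ((fderiv ℝ P w).comp (ContinuousLinearMap.inr ℝ E E)) w.2) z :=
        ((ContinuousLinearMap.smulRightL ℝ E E).differentiableAt.comp z h1).clm_apply
          differentiableAt_snd
      exact (hd.smul_const _).add h2
    exact this.congr_of_eventuallyEq (Filter.mem_of_superset (slit_mem_nhds hU hz)
      fun w hw => nonlinConn_sprayOf hU hP hw)
  have h1 : fderiv ℝ (fun w => nonlinConn (sprayOf P) w ξ) z v =
      fderiv ℝ (nonlinConn (sprayOf P)) z v ξ := by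
    rw [fderiv_clm_apply hN (differentiableAt_const ξ)]
    simp
  have h2 : ∀ w ∈ slit U, nonlinConn (sprayOf P) w ξ = P w • ξ + fderiv ℝ P w (0, ξ) • w.2 := by
    intro w hw
    rw [nonlinConn_sprayOf hU hP hw]
    simp
  have h3 : HasFDerivAt (fun w => fderiv ℝ P w (0, ξ)) _ z :=
    hd2.hasFDerivAt.clm_apply (hasFDerivAt_const ((0, ξ) : E × E) z)
  have h4 := (hd.hasFDerivAt.smul_const ξ).add
    (h3.smul (hasFDerivAt_snd (𝕜 := ℝ) (p := z)))
  rw [← h1, fderiv_congr_slit hU h2 hz]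
  erw [h4.fderiv]
  simp [add_comm]

/-- The Jacobi endomorphism of `S₀ - 2 P 𝒞` when `∂P/∂xⁱ - P ∂P/∂yⁱ = λ F ∂F/∂yⁱ`. -/
theorem jacobiEndo_sprayOf (hU : IsOpen U) (hP : IsHomogeneousOne U P)
    (hF : IsHomogeneousOne U F) {l : ℝ}
    (hPF : ∀ z ∈ slit U, ∀ ξ : E, fderiv ℝ P z (ξ, 0) =
      P z * fderiv ℝ P z (0, ξ) + l * (F z * fderiv ℝ F z (0, ξ))) (hz : z ∈ slit U) (ξ : E) :
    jacobiEndo (sprayOf P) z ξ =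
      (-l * F z ^ 2) • ξ - (-l * F z * fderiv ℝ F z (0, ξ)) • z.2 := by
  have h0 : ∀ w ∈ slit U, fderiv ℝ P w (w.2, 0) = P w ^ 2 + l * F w ^ 2 := by
    intro w hw
    rw [hPF w hw, hP.fderiv_vertical hU hw, hF.fderiv_vertical hU hw]
    ring
  have hdP := differentiableAt_of_slit hU hP.1 hz
  have hdF := differentiableAt_of_slit hU hF.1 hz
  -- The mixed second derivative comes from differentiating `h0` along the fibre.
  have hmix : fderiv ℝ (fderiv ℝ P) z (z.2, 0) (0, ξ) =
      2 * P z * fderiv ℝ P z (0, ξ) + 2 * l * (F z * fderiv ℝ F z (0, ξ))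
        - fderiv ℝ P z (ξ, 0) := by
    have h1 := fderiv_flat_vertical hU hP.1 hz ξ
    rw [fderiv_congr_slit hU h0 hz, fderiv_fun_add (hdP.fun_pow 2) ((hdF.fun_pow 2).const_mul l),
      fderiv_const_mul (hdF.fun_pow 2)] at h1
    rw [fderiv_sq hU hP.1 hz, fderiv_sq hU hF.1 hz] at h1
    simp at h1
    linarith
  have hN : nonlinConn (sprayOf P) z ξ = P z • ξ + fderiv ℝ P z (0, ξ) • z.2 := by
    rw [nonlinConn_sprayOf hU hP hz]; simp
  have hNN : nonlinConn (sprayOf P) z (P z • ξ + fderiv ℝ P z (0, ξ) • z.2) =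
      (P z ^ 2) • ξ + (3 * P z * fderiv ℝ P z (0, ξ)) • z.2 := by
    rw [map_add, map_smul, map_smul, hN, nonlinConn_sprayOf hU hP hz]
    simp [hP.fderiv_vertical hU hz]
    module
  -- The horizontal lift of `ξ` is split so that its Liouville part is handled by Euler's identity.
  have hsplit : ((ξ, -(P z • ξ + fderiv ℝ P z (0, ξ) • z.2)) : E × E) =
      (ξ, 0) - P z • ((0, ξ) : E × E) - fderiv ℝ P z (0, ξ) • ((0, z.2) : E × E) := by
    ext <;> simp
    abel
  rw [jacobiEndo, fderiv_sprayCoeff_sprayOf hU hP hz, fderiv_nonlinConn_sprayOf hU hP hz, hN, hNN]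
  dsimp only
  rw [hsplit, sprayOf_eq]
  simp only [map_sub, map_smul, sub_apply, smul_apply,
    smul_eq_mul, hP.fderiv_vertical hU hz, hP.fderiv_fderiv_vertical_vertical hU hz, hmix,
    h0 z hz, hPF z hz, Prod.snd_sub, Prod.smul_snd]
  module

end SlitCalculus

/-! ### The Funk equation and sums of solutions with opposite constants -/

section FunkEquation

variable {E : Type*} [NormedAddCommGroup E] [NormedSpace ℝ E] {U : Set E}
  {F G b : E × E → ℝ} {z : E × E} {c : ℝ}

/-- Solutions of the Funk equation `∂G/∂xⁱ = 2 c G ∂G/∂yⁱ`. -/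
def IsFunk (U : Set E) (c : ℝ) (G : E × E → ℝ) : Prop :=
  IsHomogeneousOne U G ∧
    ∀ z ∈ slit U, ∀ ξ : E, fderiv ℝ G z (ξ, 0) = 2 * c * G z * fderiv ℝ G z (0, ξ)

theorem IsFunk.energy (hU : IsOpen U) (hG : IsFunk U c G) (hz : z ∈ slit U) :
    fderiv ℝ G z (z.2, 0) = 2 * c * G z ^ 2 := by
  rw [hG.2 z hz, hG.1.fderiv_vertical hU hz]
  ring

/-- Differentiating `S₀G = 2cG²` along the fibre gives `4cG ∂G/∂yⁱ = 2 ∂G/∂xⁱ` on one side, and the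
mixed derivative plus `∂G/∂xⁱ` on the other. -/
theorem IsFunk.hamel (hU : IsOpen U) (hG : IsFunk U c G) (hz : z ∈ slit U) (ξ : E) :
    fderiv ℝ (fderiv ℝ G) z (z.2, 0) (0, ξ) = fderiv ℝ G z (ξ, 0) := by
  have h := fderiv_flat_vertical hU hG.1.1 hz ξ
  have hd := differentiableAt_of_slit hU hG.1.1 hz
  rw [fderiv_congr_slit hU (fun w hw => hG.energy hU hw) hz, fderiv_const_mul (hd.fun_pow 2),
    fderiv_sq hU hG.1.1 hz] at h
  have h2 := hG.2 z hz ξ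
  simp at h
  linarith

theorem IsHomogeneousOne.add (hF : IsHomogeneousOne U F) (hb : IsHomogeneousOne U b) :
    IsHomogeneousOne U (fun z => F z + b z) :=
  ⟨hF.1.add hb.1, fun x hx y hy t ht => by
    simp only [hF.2 x hx y hy t ht, hb.2 x hx y hy t ht]; ring⟩

theorem IsHomogeneousOne.const_mul (hF : IsHomogeneousOne U F) (a : ℝ) :
    IsHomogeneousOne U (fun z => a * F z) :=
  ⟨contDiffOn_const.mul hF.1, fun x hx y hy t ht => by
    simp only [hF.2 x hx y hy t ht]; ring⟩

theorem IsHomogeneousOne.sub (hF : IsHomogeneousOne U F) (hb : IsHomogeneousOne U b) :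
    IsHomogeneousOne U (fun z => F z - b z) :=
  ⟨hF.1.sub hb.1, fun x hx y hy t ht => by
    simp only [hF.2 x hx y hy t ht, hb.2 x hx y hy t ht]; ring⟩

theorem fderiv_add_slit (hU : IsOpen U) (hF : ContDiffOn ℝ ∞ F (slit U))
    (hb : ContDiffOn ℝ ∞ b (slit U)) (hz : z ∈ slit U) :
    fderiv ℝ (fun w => F w + b w) z = fderiv ℝ F z + fderiv ℝ b z :=
  fderiv_fun_add (differentiableAt_of_slit hU hF hz) (differentiableAt_of_slit hU hb hz)

theorem fderiv_fderiv_add_slit (hU : IsOpen U) (hF : ContDiffOn ℝ ∞ F (slit U))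
    (hb : ContDiffOn ℝ ∞ b (slit U)) (hz : z ∈ slit U) :
    fderiv ℝ (fderiv ℝ fun w => F w + b w) z =
      fderiv ℝ (fderiv ℝ F) z + fderiv ℝ (fderiv ℝ b) z := by
  rw [fderiv_congr_slit hU (fun w hw => fderiv_add_slit hU hF hb hw) hz]
  exact fderiv_fun_add (differentiableAt_fderiv_of_slit hU hF hz)
    (differentiableAt_fderiv_of_slit hU hb hz)

/-- The geodesic spray of the sum of two solutions of Funk equations with opposite constants. -/
theorem IsFunk.isGeodesicSpray_add (hU : IsOpen U) (hF : IsFunk U c F) (hb : IsFunk U (-c) b) :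
    IsGeodesicSpray U (fun z => F z + b z) (sprayOf fun z => c * (F z - b z)) := by
  refine isGeodesicSpray_sprayOf hU (hF.1.add hb.1) ((hF.1.sub hb.1).const_mul c) ?_ ?_
  · intro z hz
    rw [fderiv_add_slit hU hF.1.1 hb.1.1 hz, add_apply, hF.energy hU hz, hb.energy hU hz]
    ring
  · intro z hz ξ
    rw [fderiv_add_slit hU hF.1.1 hb.1.1 hz, fderiv_fderiv_add_slit hU hF.1.1 hb.1.1 hz]
    simp only [add_apply, hF.hamel hU hz, hb.hamel hU hz]

/-- For `P = c(F - b)` the hypothesis of `jacobiEndo_sprayOf` holds with `l = c²`: the cross terms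
of `P ∂P/∂yⁱ` supply exactly those of `(F + b) ∂(F + b)/∂yⁱ`. -/
theorem IsFunk.hasConstFlagCurv_add (hU : IsOpen U) (hF : IsFunk U c F) (hb : IsFunk U (-c) b) :
    HasConstFlagCurv U (fun z => F z + b z) (-(c ^ 2)) := by
  refine ⟨_, hF.isGeodesicSpray_add hU hb, fun z hz ξ =>
    jacobiEndo_sprayOf hU ((hF.1.sub hb.1).const_mul c) (hF.1.add hb.1) ?_ hz ξ⟩
  intro w hw ξ
  have hdF := differentiableAt_of_slit hU hF.1.1 hw
  have hdb := differentiableAt_of_slit hU hb.1.1 hw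
  rw [fderiv_add_slit hU hF.1.1 hb.1.1 hw, fderiv_const_mul (hdF.fun_sub hdb),
    fderiv_fun_sub hdF hdb]
  simp only [add_apply, sub_apply, smul_apply, smul_eq_mul, hF.2 w hw, hb.2 w hw]
  ring

/-- Makes the undeformed metric the case `b = 0` of the results on sums. -/
theorem isFunk_zero : IsFunk U c (fun _ => 0) :=
  ⟨⟨contDiffOn_const, by simp⟩, by simp⟩

theorem IsFunk.isGeodesicSpray (hU : IsOpen U) (hF : IsFunk U c F) :
    IsGeodesicSpray U F (sprayOf fun z => c * F z) := by
  simpa using hF.isGeodesicSpray_add hU isFunk_zero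

theorem IsFunk.hasConstFlagCurv (hU : IsOpen U) (hF : IsFunk U c F) :
    HasConstFlagCurv U F (-(c ^ 2)) := by
  simpa using hF.hasConstFlagCurv_add hU isFunk_zero

theorem IsFunk.projFlat (hU : IsOpen U) (hF : IsFunk U c F) :
    ProjFlat U F (fun z => c * F z) :=
  ⟨_, hF.isGeodesicSpray hU, hF.1.const_mul c, fun _ _ => rfl⟩

theorem IsFunk.projFlat_add (hU : IsOpen U) (hF : IsFunk U c F) (hb : IsFunk U (-c) b) :
    ProjFlat U (fun z => F z + b z) (fun z => c * (F z - b z)) :=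
  ⟨_, hF.isGeodesicSpray_add hU hb, (hF.1.sub hb.1).const_mul c, fun _ _ => rfl⟩

theorem IsFunk.projRelated_add (hU : IsOpen U) (hF : IsFunk U c F) (hb : IsFunk U (-c) b) :
    ProjRelated U F (fun z => F z + b z) (fun z => -c * b z) := by
  refine ⟨_, _, hF.isGeodesicSpray hU, hF.isGeodesicSpray_add hU hb, hb.1.const_mul _,
    fun z _ => ?_⟩
  simp only [sprayOf]
  module

/-- Multiples of solutions of the Funk equation are Hamel functions of projectively flat sprays. -/
theorem IsFunk.isHamel_const_mul (hU : IsOpen U) (hb : IsFunk U c b) {Q : E × E → ℝ}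
    {S : E × E → E × E} (hS : ∀ z ∈ slit U, S z = sprayOf Q z) (a : ℝ) :
    IsHamel U S (fun z => a * b z) := by
  refine isHamel_of_flat hU (hb.1.const_mul a) (fun z hz ξ => ?_) hS
  rw [fderiv_congr_slit hU (fun w hw =>
      fderiv_const_mul (differentiableAt_of_slit hU hb.1.1 hw) a) hz,
    fderiv_const_mul (differentiableAt_of_slit hU hb.1.1 hz),
    fderiv_fun_const_smul (differentiableAt_fderiv_of_slit hU hb.1.1 hz)]
  simp only [smul_apply, hb.hamel hU hz]

end FunkEquation

/-! ### Linear solutions of the Funk equation -/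

section Forms

variable {E : Type*} [NormedAddCommGroup E] [NormedSpace ℝ E] {U : Set E}
  {β : E → (E →L[ℝ] ℝ)} {z : E × E}

theorem contDiffOn_ofForm (hβ : ContDiffOn ℝ ∞ β U) : ContDiffOn ℝ ∞ (ofForm β) (slit U) := by
  unfold ofForm
  exact (hβ.comp contDiffOn_fst fun z hz => hz.1).clm_apply contDiffOn_snd

theorem isHomogeneousOne_ofForm (hβ : ContDiffOn ℝ ∞ β U) : IsHomogeneousOne U (ofForm β) :=
  ⟨contDiffOn_ofForm hβ, fun x _ y _ t _ => by simp [ofForm]⟩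

theorem fderiv_ofForm (hU : IsOpen U) (hβ : ContDiffOn ℝ ∞ β U) (hz : z.1 ∈ U) (u : E × E) :
    fderiv ℝ (ofForm β) z u = fderiv ℝ β z.1 u.1 z.2 + β z.1 u.2 := by
  have hd : DifferentiableAt ℝ β z.1 :=
    (hβ.contDiffAt (hU.mem_nhds hz)).differentiableAt (by simp)
  have h1 : HasFDerivAt (fun w : E × E => β w.1)
      ((fderiv ℝ β z.1).comp (ContinuousLinearMap.fst ℝ E E)) z :=
    hd.hasFDerivAt.comp z hasFDerivAt_fst
  have h2 : HasFDerivAt (ofForm β) _ z := h1.clm_apply (hasFDerivAt_snd (𝕜 := ℝ) (p := z))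
  rw [h2.fderiv]
  simp [add_comm]

theorem fderiv_fderiv_ofForm (hU : IsOpen U) (hβ : ContDiffOn ℝ ∞ β U) (hz : z ∈ slit U)
    (v : E × E) (ξ : E) :
    fderiv ℝ (fderiv ℝ (ofForm β)) z v (0, ξ) = fderiv ℝ β z.1 v.1 ξ := by
  have hd : DifferentiableAt ℝ β z.1 :=
    (hβ.contDiffAt (hU.mem_nhds hz.1)).differentiableAt (by simp)
  have h1 : HasFDerivAt (fun w : E × E => β w.1)
      ((fderiv ℝ β z.1).comp (ContinuousLinearMap.fst ℝ E E)) z :=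
    hd.hasFDerivAt.comp z hasFDerivAt_fst
  have h2 : HasFDerivAt (fun w : E × E => β w.1 ξ) _ z :=
    h1.clm_apply (hasFDerivAt_const ξ z)
  have h3 : ∀ w ∈ slit U, fderiv ℝ (ofForm β) w (0, ξ) = β w.1 ξ := by
    intro w hw
    simp [fderiv_ofForm hU hβ hw.1]
  rw [← fderiv_fderiv_apply hU (contDiffOn_ofForm hβ) hz, fderiv_congr_slit hU h3 hz, h2.fderiv]
  simp

theorem isFunk_ofForm (hU : IsOpen U) (hβ : ContDiffOn ℝ ∞ β U) {c : ℝ}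
    (h : ∀ x ∈ U, ∀ u v : E, fderiv ℝ β x u v = 2 * c * β x u * β x v) :
    IsFunk U c (ofForm β) := by
  refine ⟨isHomogeneousOne_ofForm hβ, fun z hz ξ => ?_⟩
  rw [fderiv_ofForm hU hβ hz.1, fderiv_ofForm hU hβ hz.1, h z.1 hz.1]
  simp [ofForm]
  ring

/-- A 1-form with `∂ᵢβⱼ = 2 ν βᵢ βⱼ` on a convex open set is determined by its value at a point. -/
theorem form_mul_eq_of_fderiv (hU : IsOpen U) (hUc : Convex ℝ U) (hβ : ContDiffOn ℝ ∞ β U) {ν : ℝ}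
    (h : ∀ x ∈ U, ∀ u v : E, fderiv ℝ β x u v = 2 * ν * β x u * β x v) {x₀ x : E} (hx₀ : x₀ ∈ U)
    (hx : x ∈ U) (w : E) :
    (1 - 2 * ν * β x₀ (x - x₀)) * β x w = β x₀ w := by
  have hmem : ∀ t ∈ Icc (0 : ℝ) 1, x₀ + t • (x - x₀) ∈ U := fun t ht =>
    hUc.add_smul_sub_mem hx₀ hx ht
  have hγ : ContinuousOn (fun t : ℝ => β (x₀ + t • (x - x₀))) (Icc 0 1) :=
    hβ.continuousOn.comp (by fun_prop) hmem
  obtain ⟨C, hC⟩ := isCompact_Icc.exists_bound_of_continuousOn hγ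
  -- `Ψ` measures the failure of the claimed formula along the segment. It vanishes at `0` and
  -- satisfies a linear equation, so Grönwall's inequality forces `Ψ = 0`; the bound `C` on `β`
  -- along the segment gives the constant `K`.
  set Ψ : ℝ → (E →L[ℝ] ℝ) := fun t =>
    (1 - 2 * ν * β x₀ (x - x₀) * t) • β (x₀ + t • (x - x₀)) - β x₀ with hΨ
  have hd : ∀ t ∈ Icc (0 : ℝ) 1, HasDerivAt Ψ
      ((2 * ν * Ψ t (x - x₀)) • β (x₀ + t • (x - x₀))) t := by
    intro t ht
    have h1 : HasDerivAt (fun t : ℝ => x₀ + t • (x - x₀)) (x - x₀) t := by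
      simpa using ((hasDerivAt_id t).smul_const (x - x₀)).const_add x₀
    have h2 : HasFDerivAt β (fderiv ℝ β (x₀ + t • (x - x₀))) (x₀ + t • (x - x₀)) :=
      ((hβ.contDiffAt (hU.mem_nhds (hmem t ht))).differentiableAt (by simp)).hasFDerivAt
    have h3 : HasDerivAt (fun t : ℝ => β (x₀ + t • (x - x₀)))
        (fderiv ℝ β (x₀ + t • (x - x₀)) (x - x₀)) t := h2.comp_hasDerivAt t h1
    have h4 : HasDerivAt (fun t : ℝ => 1 - 2 * ν * β x₀ (x - x₀) * t)
        (-(2 * ν * β x₀ (x - x₀))) t := by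
      simpa using ((hasDerivAt_id t).const_mul (2 * ν * β x₀ (x - x₀))).const_sub 1
    have h5 := (h4.fun_smul h3).sub_const (β x₀)
    refine h5.congr_deriv ?_
    ext v
    simp [hΨ, h _ (hmem t ht)]
    ring
  have hz := eq_zero_of_abs_deriv_le_mul_abs_self_of_eq_zero_right (f := Ψ)
    (K := |2 * ν| * ‖x - x₀‖ * C) (a := 0) (b := 1)
    (fun t ht => (hd t ht).continuousAt.continuousWithinAt)
    (fun t ht => (hd t ⟨ht.1, ht.2.le⟩).hasDerivWithinAt) (by simp [hΨ]) ?_ 1 (by simp)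
  · have := congrArg (fun L : E →L[ℝ] ℝ => L w) hz
    simp [hΨ] at this
    simp
    linarith
  · intro t ht
    rw [norm_smul, norm_mul, Real.norm_eq_abs]
    have hC' := hC t ⟨ht.1, ht.2.le⟩
    calc |2 * ν| * ‖Ψ t (x - x₀)‖ * ‖β (x₀ + t • (x - x₀))‖
        ≤ |2 * ν| * (‖Ψ t‖ * ‖x - x₀‖) * C := by
          gcongr
          exact (Ψ t).le_opNorm _
      _ = _ := by ring

end Forms

/-! ### The implicit equation `F = ‖y + 2cFx‖` and nondegeneracy -/

section Implicit

variable {E : Type*} [NormedAddCommGroup E] [InnerProductSpace ℝ E] {U : Set E}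
  {F : E × E → ℝ} {z : E × E} {c : ℝ}

/-- `F` solves the equation `F = ‖y + 2 c F x‖` on `T₀U`, of which it is a simple root. -/
structure IsFunkRoot (U : Set E) (c : ℝ) (F : E × E → ℝ) : Prop where
  homogeneous : IsHomogeneousOne U F
  pos : ∀ z ∈ slit U, 0 < F z
  sq_eq : ∀ z ∈ slit U, F z ^ 2 = ‖z.2 + (2 * c * F z) • z.1‖ ^ 2
  simple : ∀ z ∈ slit U, 0 < F z - 2 * c * inner ℝ (z.2 + (2 * c * F z) • z.1) z.1

theorem IsFunkRoot.fderiv_eq (hU : IsOpen U) (hF : IsFunkRoot U c F) (hz : z ∈ slit U)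
    (u : E × E) :
    F z * fderiv ℝ F z u = inner ℝ (z.2 + (2 * c * F z) • z.1)
      (u.2 + (2 * c * F z) • u.1 + (2 * c * fderiv ℝ F z u) • z.1) := by
  have hd := differentiableAt_of_slit hU hF.homogeneous.1 hz
  have hm := (hasFDerivAt_snd (𝕜 := ℝ) (p := z)).fun_add
    ((hd.hasFDerivAt.const_mul (2 * c)).fun_smul (hasFDerivAt_fst (𝕜 := ℝ) (p := z)))
  have h := fderiv_congr_slit hU hF.sq_eq hz
  rw [fderiv_sq hU hF.homogeneous.1 hz, hm.norm_sq.fderiv] at h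
  have hu := congrArg (fun L : E × E →L[ℝ] ℝ => L u) h
  simp only [smul_apply, ContinuousLinearMap.comp_apply, add_apply,
    ContinuousLinearMap.smulRight_apply, ContinuousLinearMap.coe_fst',
    ContinuousLinearMap.coe_snd', innerSL_apply_apply, smul_eq_mul, nsmul_eq_mul,
    Nat.cast_ofNat] at hu
  rw [add_assoc]
  linarith

/-- An increment `ξ` of `x` moves `y + 2cFx` as the increment `2cFξ` of `y` does, for fixed `F`.
Simplicity of the root allows the common coefficient to be cancelled. -/
theorem IsFunkRoot.isFunk (hU : IsOpen U) (hF : IsFunkRoot U c F) : IsFunk U c F := by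
  refine ⟨hF.homogeneous, fun z hz ξ => ?_⟩
  have h1 := hF.fderiv_eq hU hz (ξ, 0)
  have h2 := hF.fderiv_eq hU hz (0, ξ)
  have hK := hF.simple z hz
  simp only [smul_zero, zero_add, add_zero] at h1 h2
  rw [inner_add_right, real_inner_smul_right, real_inner_smul_right] at h1
  rw [inner_add_right, real_inner_smul_right] at h2
  refine mul_left_cancel₀ hK.ne' ?_
  linear_combination h1 - 2 * c * F z * h2

/-- Put `m = y + 2cFx` and let a subscript `ξ` denote the fibre derivative. A second differentiation
gives `‖m_ξ‖² - F_ξ²`; as `‖m‖ = F` and `⟨m, m_ξ⟩ = F F_ξ`, this is `‖m_ξ - (F_ξ/F) m‖²`, where the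
multiples of `x` cancel. -/
theorem IsFunkRoot.fderiv_fderiv_vertical (hU : IsOpen U) (hF : IsFunkRoot U c F)
    (hz : z ∈ slit U) (ξ : E) :
    (F z - 2 * c * inner ℝ (z.2 + (2 * c * F z) • z.1) z.1)
        * fderiv ℝ (fderiv ℝ F) z (0, ξ) (0, ξ) =
      ‖ξ - (fderiv ℝ F z (0, ξ) / F z) • z.2‖ ^ 2 := by
  have hd := (differentiableAt_of_slit hU hF.homogeneous.1 hz).hasFDerivAt
  have hm := (hasFDerivAt_snd (𝕜 := ℝ) (p := z)).fun_add
    ((hd.const_mul (2 * c)).fun_smul (hasFDerivAt_fst (𝕜 := ℝ) (p := z)))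
  have hφ : HasFDerivAt (fun w => fderiv ℝ F w (0, ξ)) _ z :=
    (differentiableAt_fderiv_of_slit hU hF.homogeneous.1 hz).hasFDerivAt.clm_apply
      (hasFDerivAt_const ((0, ξ) : E × E) z)
  have hp := ((hφ.const_mul (2 * c)).fun_smul (hasFDerivAt_fst (𝕜 := ℝ) (p := z))).const_add ξ
  have h := fderiv_congr_slit hU (fun w hw => by
    have := hF.fderiv_eq hU hw (0, ξ)
    simpa only [smul_zero, add_zero] using this) hz
  rw [(hd.fun_mul hφ).fderiv, (hm.inner ℝ hp).fderiv] at h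
  have hu := congrArg (fun L : E × E →L[ℝ] ℝ => L (0, ξ)) h
  have h1 := hF.fderiv_eq hU hz (0, ξ)
  have hsq := hF.sq_eq z hz
  have hpos := hF.pos z hz
  simp [fderivInnerCLM_apply] at hu
  simp only [smul_zero, add_zero] at h1
  have key : ξ - (fderiv ℝ F z (0, ξ) / F z) • z.2 =
      (ξ + (2 * c * fderiv ℝ F z (0, ξ)) • z.1)
        - (fderiv ℝ F z (0, ξ) / F z) • (z.2 + (2 * c * F z) • z.1) := by
    have : 2 * c * fderiv ℝ F z (0, ξ) = (fderiv ℝ F z (0, ξ) / F z) * (2 * c * F z) := by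
      field_simp
    rw [smul_add, smul_smul, ← this]
    abel
  rw [key, norm_sub_sq_real, norm_smul, mul_pow, ← hsq, real_inner_smul_right,
    real_inner_comm (z.2 + _), ← h1, Real.norm_eq_abs, sq_abs, div_pow]
  simp only [real_inner_smul_right] at hu
  have e1 : fderiv ℝ F z (0, ξ) / F z * (F z * fderiv ℝ F z (0, ξ)) = fderiv ℝ F z (0, ξ) ^ 2 := by
    field_simp
  have e2 : fderiv ℝ F z (0, ξ) ^ 2 / F z ^ 2 * F z ^ 2 = fderiv ℝ F z (0, ξ) ^ 2 := by
    field_simp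
  rw [e1, e2]
  linarith

theorem IsFunkRoot.isFinsler_randersDeform (hU : IsOpen U) (hF : IsFunkRoot U c F)
    (hFc : ContinuousOn F (U ×ˢ (univ : Set E)))
    (hFh : ∀ x ∈ U, ∀ y : E, ∀ t : ℝ, 0 < t → F (x, t • y) = t * F (x, y))
    {β : E → (E →L[ℝ] ℝ)} (hβ : ContDiffOn ℝ ∞ β U)
    (hpos : ∀ z ∈ slit U, 0 < randersDeform F β z) : IsFinsler U (randersDeform F β) where
  continuousOn := by
    refine hFc.add ?_
    unfold ofForm
    exact (hβ.continuousOn.comp continuousOn_fst fun z hz => hz.1).clm_apply continuousOn_snd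
  smooth := hF.homogeneous.1.add (contDiffOn_ofForm hβ)
  pos := hpos
  homogeneous x hx y t ht := by
    simp only [randersDeform, hFh x hx y t ht, ofForm, map_smul, smul_eq_mul]
    ring
  nondegenerate z hz ξ h := by
    have hh := hF.homogeneous.add (isHomogeneousOne_ofForm hβ)
    -- On the diagonal the metric tensor is the square of the first derivative plus `F + β` times
    -- the Hessian, both nonnegative. Both vanish: the Hessian makes `ξ` a multiple of `y`, and the
    -- first derivative makes that multiple zero.
    have h1 := h ξ
    unfold randersDeform at h1
    rw [metricTensor_eq hU hh.1 hz,
      fderiv_fderiv_add_slit hU hF.homogeneous.1 (contDiffOn_ofForm hβ) hz, add_apply, add_apply,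
      fderiv_fderiv_ofForm hU hβ hz] at h1
    have hp := hpos z hz
    unfold randersDeform at hp
    have hK := hF.simple z hz
    have h2 := hF.fderiv_fderiv_vertical hU hz ξ
    have h3 : 0 ≤ fderiv ℝ (fderiv ℝ F) z (0, ξ) (0, ξ) :=
      nonneg_of_mul_nonneg_right (h2 ▸ sq_nonneg _) hK
    simp only [map_zero, zero_apply, add_zero] at h1
    have h4 := mul_nonneg hp.le h3
    have h5 := mul_self_nonneg (fderiv ℝ (fun w => F w + ofForm β w) z (0, ξ))
    have h6 : fderiv ℝ (fun w => F w + ofForm β w) z (0, ξ) = 0 :=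
      mul_self_eq_zero.1 (by linarith)
    have h7 : fderiv ℝ (fderiv ℝ F) z (0, ξ) (0, ξ) = 0 :=
      (mul_eq_zero.1 (by linarith)).resolve_left hp.ne'
    rw [h7, mul_zero, eq_comm, sq_eq_zero_iff, norm_eq_zero, sub_eq_zero] at h2
    set l := fderiv ℝ F z (0, ξ) / F z
    have h8 : ((0, ξ) : E × E) = l • (0, z.2) := by rw [h2]; simp
    rw [h8, map_smul, hh.fderiv_vertical hU hz, smul_eq_mul] at h6
    rw [h2, (mul_eq_zero.1 h6).resolve_right hp.ne', zero_smul]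

end Implicit

/-! ### Deformations with projective factor proportional to the form -/

section Converse

variable {E : Type*} [NormedAddCommGroup E] [NormedSpace ℝ E] {U : Set E}
  {F : E × E → ℝ} {β : E → (E →L[ℝ] ℝ)} {c μ : ℝ} {S' : E × E → E × E}

theorem energy_form (hU : IsOpen U) (hF : IsFunk U c F) (hβ : ContDiffOn ℝ ∞ β U)
    (hFβ : IsFinsler U (randersDeform F β)) (hS' : IsGeodesicSpray U (randersDeform F β) S')
    (hS'Q : ∀ z ∈ slit U, S' z = sprayOf (fun w => c * F w + μ * ofForm β w) z)
    {z : E × E} (hz : z ∈ slit U) :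
    fderiv ℝ β z.1 z.2 z.2 = 2 * (c + μ) * F z * β z.1 z.2 + 2 * μ * β z.1 z.2 ^ 2 := by
  have h := energy_of_isGeodesicSpray hU hFβ.isHomogeneousOne hFβ.pos hS' hS'Q hz
  unfold randersDeform at h
  rw [fderiv_add_slit hU hF.1.1 (contDiffOn_ofForm hβ) hz, add_apply, hF.energy hU hz,
    fderiv_ofForm hU hβ hz.1] at h
  simp only [ofForm, map_zero, add_zero] at h
  linear_combination h

theorem factor_eq_of_projRelated (hU : IsOpen U) (hF : IsFunk U c F)
    (hFpos : ∀ z ∈ slit U, 0 < F z) (hβ : ContDiffOn ℝ ∞ β U) (hβ0 : ∃ x ∈ U, β x ≠ 0)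
    (hFβ : IsFinsler U (randersDeform F β)) (hS' : IsGeodesicSpray U (randersDeform F β) S')
    (hS'Q : ∀ z ∈ slit U, S' z = sprayOf (fun w => c * F w + μ * ofForm β w) z) : μ = -c := by
  obtain ⟨x, hx, hne⟩ := hβ0
  obtain ⟨y, hy⟩ : ∃ y, β x y ≠ 0 := by
    by_contra! h
    exact hne (ContinuousLinearMap.ext h)
  have hy0 : y ≠ 0 := by
    rintro rfl
    simp at hy
  have hz : (x, y) ∈ slit U := ⟨hx, hy0⟩
  -- The terms quadratic in `y` agree at `y` and `-y`, so subtraction leaves only the term with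
  -- factor `c + μ`.
  have hz' : (x, -y) ∈ slit U := ⟨hx, neg_ne_zero.2 hy0⟩
  have h1 := energy_form hU hF hβ hFβ hS' hS'Q hz
  have h2 := energy_form hU hF hβ hFβ hS' hS'Q hz'
  simp only [map_neg, neg_apply, neg_neg] at h2
  have hsum : 0 < F (x, y) + F (x, -y) := add_pos (hFpos _ hz) (hFpos _ hz')
  have h3 : (c + μ) * (β x y * (F (x, y) + F (x, -y))) = 0 := by
    linear_combination (h2 - h1) / 2
  have := (mul_eq_zero.1 h3).resolve_right (mul_ne_zero hy hsum.ne')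
  linarith

/-- The energy identity gives the quadratic form of `∂β`, the Hamel identity gives its symmetry (`β`
is closed), and polarization concludes. -/
theorem fderiv_form_of_projRelated (hU : IsOpen U) (hF : IsFunk U c F) (hβ : ContDiffOn ℝ ∞ β U)
    (hFβ : IsFinsler U (randersDeform F β)) (hS' : IsGeodesicSpray U (randersDeform F β) S')
    (hS'Q : ∀ z ∈ slit U, S' z = sprayOf (fun w => c * F w + -c * ofForm β w) z)
    {x : E} (hx : x ∈ U) (u v : E) :
    fderiv ℝ β x u v = 2 * -c * β x u * β x v := by
  have hsq : ∀ y, fderiv ℝ β x y y = 2 * -c * β x y ^ 2 := by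
    intro y
    by_cases hy : y = 0
    · simp [hy]
    · have := energy_form hU hF hβ hFβ hS' hS'Q (z := (x, y)) ⟨hx, hy⟩
      simp only at this
      linear_combination this
  have hsymm : ∀ y ξ, fderiv ℝ β x y ξ = fderiv ℝ β x ξ y := by
    intro y ξ
    by_cases hy : y = 0
    · simp [hy]
    · have hz : (x, y) ∈ slit U := ⟨hx, hy⟩
      have h := hamel_of_isGeodesicSpray hU hFβ.isHomogeneousOne hFβ.pos hS' hS'Q hz ξ
      unfold randersDeform at h
      rw [fderiv_add_slit hU hF.1.1 (contDiffOn_ofForm hβ) hz,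
        fderiv_fderiv_add_slit hU hF.1.1 (contDiffOn_ofForm hβ) hz, add_apply, add_apply,
        add_apply, hF.hamel hU hz, fderiv_fderiv_ofForm hU hβ hz, fderiv_ofForm hU hβ hx] at h
      simpa using h
  have h := hsq (u + v)
  simp only [map_add, add_apply, hsq, hsymm v u] at h
  linarith

end Converse

/-! ### The explicit metric, the form `b̄`, and the Funk metrics -/

section Randers

variable {n : ℕ} {U : Set (EuclideanSpace ℝ (Fin n))} {c ν : ℝ}

theorem one_sub_norm_sq_pos_of_subset_ball (hc : c ≠ 0) (hUb : U ⊆ ball 0 (1 / (2 * |c|)))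
    {x : EuclideanSpace ℝ (Fin n)} (hx : x ∈ U) : 0 < 1 - 4 * c ^ 2 * ‖x‖ ^ 2 := by
  have h := hUb hx
  rw [mem_ball_zero_iff, lt_div_iff₀ (by positivity)] at h
  have h0 : 0 ≤ ‖x‖ * (2 * |c|) := by positivity
  have h1 : (‖x‖ * (2 * |c|)) ^ 2 < 1 := by nlinarith
  rw [mul_pow, mul_pow, sq_abs] at h1
  linarith

theorem aPart_radicand_pos {x y : EuclideanSpace ℝ (Fin n)}
    (hx : 0 < 1 - 4 * c ^ 2 * ‖x‖ ^ 2) (hy : y ≠ 0) :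
    0 < ‖y‖ ^ 2 - 4 * c ^ 2 * (‖x‖ ^ 2 * ‖y‖ ^ 2 - (inner ℝ x y) ^ 2) := by
  have h1 : 0 < (1 - 4 * c ^ 2 * ‖x‖ ^ 2) * ‖y‖ ^ 2 := by positivity
  have h2 : 0 ≤ 4 * c ^ 2 * (inner ℝ x y) ^ 2 := by positivity
  linarith

theorem randers_smul (x y : EuclideanSpace ℝ (Fin n)) {t : ℝ} (ht : 0 < t) :
    randers c (x, t • y) = t * randers c (x, y) := by
  have h : ‖t • y‖ ^ 2 - 4 * c ^ 2 * (‖x‖ ^ 2 * ‖t • y‖ ^ 2 - (inner ℝ x (t • y)) ^ 2) =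
      t ^ 2 * (‖y‖ ^ 2 - 4 * c ^ 2 * (‖x‖ ^ 2 * ‖y‖ ^ 2 - (inner ℝ x y) ^ 2)) := by
    rw [norm_smul, Real.norm_of_nonneg ht.le, real_inner_smul_right]
    ring
  simp only [randers, aPart, bPart]
  rw [h, Real.sqrt_mul (by positivity), Real.sqrt_sq ht.le, real_inner_smul_right]
  ring

theorem continuousOn_randers (hw : ∀ x ∈ U, 0 < 1 - 4 * c ^ 2 * ‖x‖ ^ 2) :
    ContinuousOn (randers c) (U ×ˢ (univ : Set (EuclideanSpace ℝ (Fin n)))) := by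
  have hne : ∀ z ∈ U ×ˢ (univ : Set (EuclideanSpace ℝ (Fin n))),
      1 - 4 * c ^ 2 * ‖z.1‖ ^ 2 ≠ 0 := fun z hz => (hw z.1 hz.1).ne'
  unfold randers aPart bPart
  exact (ContinuousOn.div (by fun_prop) (by fun_prop) hne).add
    (ContinuousOn.div (by fun_prop) (by fun_prop) hne)

theorem contDiffOn_randers (hw : ∀ x ∈ U, 0 < 1 - 4 * c ^ 2 * ‖x‖ ^ 2) :
    ContDiffOn ℝ ∞ (randers c) (slit U) := by
  have hne : ∀ z ∈ slit U, 1 - 4 * c ^ 2 * ‖z.1‖ ^ 2 ≠ 0 := fun z hz => (hw z.1 hz.1).ne'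
  have h1 : ContDiff ℝ ∞ fun z : EuclideanSpace ℝ (Fin n) × EuclideanSpace ℝ (Fin n) =>
      ‖z.1‖ ^ 2 := contDiff_fst.norm_sq ℝ
  have h2 : ContDiff ℝ ∞ fun z : EuclideanSpace ℝ (Fin n) × EuclideanSpace ℝ (Fin n) =>
      ‖z.2‖ ^ 2 := contDiff_snd.norm_sq ℝ
  have h3 : ContDiff ℝ ∞ fun z : EuclideanSpace ℝ (Fin n) × EuclideanSpace ℝ (Fin n) =>
      (inner ℝ z.1 z.2 : ℝ) := contDiff_fst.inner ℝ contDiff_snd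
  have hden := (contDiff_const (c := (1 : ℝ))).sub ((contDiff_const (c := 4 * c ^ 2)).mul h1)
  have hnum := h2.sub ((contDiff_const (c := 4 * c ^ 2)).mul ((h1.mul h2).sub (h3.pow 2)))
  unfold randers aPart bPart
  exact ((hnum.contDiffOn.sqrt fun z hz => (aPart_radicand_pos (hw z.1 hz.1) hz.2).ne').div
    hden.contDiffOn hne).add
    (((contDiff_const (c := 2 * c)).mul h3).contDiffOn.div hden.contDiffOn hne)

/-- The implicit equation is the quadratic `(1 - 4c²‖x‖²)F² - 4c⟨x,y⟩F - ‖y‖² = 0`. With `R` the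
square root in `aPart`, `F` is its larger root, and the simplicity expression equals `R`. -/
theorem isFunkRoot_randers (hw : ∀ x ∈ U, 0 < 1 - 4 * c ^ 2 * ‖x‖ ^ 2) :
    IsFunkRoot U c (randers c) := by
  have key : ∀ z ∈ slit U, ∃ R : ℝ, 0 < R ∧
      R ^ 2 = ‖z.2‖ ^ 2 - 4 * c ^ 2 * (‖z.1‖ ^ 2 * ‖z.2‖ ^ 2 - (inner ℝ z.1 z.2) ^ 2) ∧
      (1 - 4 * c ^ 2 * ‖z.1‖ ^ 2) * randers c z = R + 2 * c * inner ℝ z.1 z.2 := by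
    intro z hz
    have hr := aPart_radicand_pos (hw z.1 hz.1) hz.2
    refine ⟨_, Real.sqrt_pos.2 hr, Real.sq_sqrt hr.le, ?_⟩
    have := (hw z.1 hz.1).ne'
    simp only [randers, aPart, bPart]
    field_simp
  refine ⟨⟨contDiffOn_randers hw, fun x _ y _ t ht => randers_smul x y ht⟩, ?_, ?_, ?_⟩
  · intro z hz
    obtain ⟨R, hR, hR2, hF⟩ := key z hz
    have hwz := hw z.1 hz.1
    have hy : 0 < ‖z.2‖ := norm_pos_iff.2 hz.2
    have h1 : 0 < (1 - 4 * c ^ 2 * ‖z.1‖ ^ 2) * ‖z.2‖ ^ 2 := by positivity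
    have h2 : |2 * c * inner ℝ z.1 z.2| < R := abs_lt_of_sq_lt_sq (by linarith) hR.le
    have h3 := (abs_lt.1 h2).1
    refine pos_of_mul_pos_right (a := 1 - 4 * c ^ 2 * ‖z.1‖ ^ 2) ?_ hwz.le
    linarith
  · intro z hz
    obtain ⟨R, hR, hR2, hF⟩ := key z hz
    have hwz := hw z.1 hz.1
    rw [norm_add_sq_real, norm_smul, mul_pow, Real.norm_eq_abs, sq_abs, real_inner_smul_right,
      real_inner_comm]
    refine mul_left_cancel₀ hwz.ne' ?_
    have hR' : R = (1 - 4 * c ^ 2 * ‖z.1‖ ^ 2) * randers c z - 2 * c * inner ℝ z.1 z.2 := by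
      linarith
    rw [hR'] at hR2
    linear_combination hR2
  · intro z hz
    obtain ⟨R, hR, hR2, hF⟩ := key z hz
    rw [inner_add_left, real_inner_smul_left, real_inner_self_eq_norm_sq, real_inner_comm]
    linarith

theorem contDiffOn_bBar {e : EuclideanSpace ℝ (Fin n)} {f : ℝ} (hν : ν ≠ 0)
    (h : ∀ x ∈ U, inner ℝ e x + f ≠ 0) : ContDiffOn ℝ ∞ (bBar ν e f) U := by
  have h1 : ContDiff ℝ ∞ fun x : EuclideanSpace ℝ (Fin n) => 2 * ν * (inner ℝ e x + f) :=
    contDiff_const.mul ((contDiff_const.inner ℝ contDiff_id).add contDiff_const)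
  unfold bBar
  exact (contDiffOn_const.div h1.contDiffOn fun x hx =>
    mul_ne_zero (mul_ne_zero two_ne_zero hν) (h x hx)).neg.smul contDiffOn_const

theorem fderiv_bBar {e : EuclideanSpace ℝ (Fin n)} {f : ℝ} (hν : ν ≠ 0)
    {x : EuclideanSpace ℝ (Fin n)} (h : inner ℝ e x + f ≠ 0) (u v : EuclideanSpace ℝ (Fin n)) :
    fderiv ℝ (bBar ν e f) x u v = 2 * ν * bBar ν e f x u * bBar ν e f x v := by
  have h1 : HasFDerivAt (fun x : EuclideanSpace ℝ (Fin n) => inner ℝ e x + f) (innerSL ℝ e) x :=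
    ((innerSL ℝ e).hasFDerivAt).add_const f
  have h2 := ((hasDerivAt_inv (mul_ne_zero (mul_ne_zero two_ne_zero hν) h)).comp_hasFDerivAt x
    (h1.const_mul (2 * ν))).fun_neg
  have h3 := h2.smul_const (innerSL ℝ e)
  have h4 : bBar ν e f = fun x => (-(2 * ν * (inner ℝ e x + f))⁻¹) • innerSL ℝ e := by
    ext x v
    simp [bBar]
  rw [h4]
  erw [h3.fderiv]
  simp
  field_simp

theorem isFunk_bBar (hU : IsOpen U) {e : EuclideanSpace ℝ (Fin n)} {f : ℝ} (hν : ν ≠ 0)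
    (h : ∀ x ∈ U, inner ℝ e x + f ≠ 0) : IsFunk U ν (ofForm (bBar ν e f)) :=
  isFunk_ofForm hU (contDiffOn_bBar hν h) fun _ hx u v => fderiv_bBar hν (h _ hx) u v

theorem exists_eq_bBar_of_fderiv (hU : IsOpen U) (hUc : Convex ℝ U) (hν : ν ≠ 0)
    {β : EuclideanSpace ℝ (Fin n) → (EuclideanSpace ℝ (Fin n) →L[ℝ] ℝ)}
    (hβ : ContDiffOn ℝ ∞ β U) (hβ0 : ∃ x ∈ U, β x ≠ 0)
    (h : ∀ x ∈ U, ∀ u v, fderiv ℝ β x u v = 2 * ν * β x u * β x v) :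
    ∃ (e : EuclideanSpace ℝ (Fin n)) (f : ℝ),
      ∀ x ∈ U, inner ℝ e x + f ≠ 0 ∧ β x = bBar ν e f x := by
  obtain ⟨x₀, hx₀, hne⟩ := hβ0
  obtain ⟨y, hy⟩ : ∃ y, β x₀ y ≠ 0 := by
    by_contra! h
    exact hne (ContinuousLinearMap.ext h)
  set e₀ := (InnerProductSpace.toDual ℝ (EuclideanSpace ℝ (Fin n))).symm (β x₀)
  have he₀ : ∀ w, inner ℝ e₀ w = β x₀ w := fun w =>
    InnerProductSpace.toDual_symm_apply
  -- Chosen so that `⟨e, x⟩ + f` is the factor `1 - 2ν β_{x₀}(x - x₀)` of `form_mul_eq_of_fderiv`; a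
  -- zero of it would force `β x₀ = 0`.
  refine ⟨(-(2 * ν)) • e₀, 1 + 2 * ν * β x₀ x₀, fun x hx => ?_⟩
  have hh : inner ℝ ((-(2 * ν)) • e₀) x + (1 + 2 * ν * β x₀ x₀) =
      1 - 2 * ν * β x₀ (x - x₀) := by
    rw [real_inner_smul_left, he₀, map_sub]
    ring
  have hmul := form_mul_eq_of_fderiv hU hUc hβ h hx₀ hx
  have hne' : 1 - 2 * ν * β x₀ (x - x₀) ≠ 0 := by
    intro h0
    have := hmul y
    rw [h0, zero_mul] at this
    exact hy this.symm
  refine ⟨hh ▸ hne', ContinuousLinearMap.ext fun w => ?_⟩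
  have : bBar ν ((-(2 * ν)) • e₀) (1 + 2 * ν * β x₀ x₀) x w =
      -(1 / (2 * ν * (1 - 2 * ν * β x₀ (x - x₀)))) * (-(2 * ν) * β x₀ w) := by
    simp only [bBar, smul_apply, innerSL_apply_apply, smul_eq_mul]
    rw [hh, real_inner_smul_left, he₀]
  rw [this, ← hmul w]
  field_simp

theorem randers_half_eq_funk :
    (randers (-(-1 / 2)) : EuclideanSpace ℝ (Fin n) × EuclideanSpace ℝ (Fin n) → ℝ) = funk := by
  ext z
  have h : (4 : ℝ) * (-(-1 / 2)) ^ 2 = 1 := by norm_num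
  have h2 : (2 : ℝ) * (-(-1 / 2)) = 1 := by norm_num
  simp only [funk, randers, aPart, bPart, h, h2, one_mul]

theorem bBar_half (e x y : EuclideanSpace ℝ (Fin n)) :
    bBar (-1 / 2) e 1 x y = inner ℝ e y / (1 + inner ℝ e x) := by
  have h : -(1 / (2 * (-1 / 2) * (inner ℝ e x + 1))) = 1 / (1 + inner ℝ e x) := by
    rw [show (2 : ℝ) * (-1 / 2) * (inner ℝ e x + 1) = -(1 + inner ℝ e x) by ring,
      one_div_neg_eq_neg_one_div, neg_neg]
  simp only [bBar, h, smul_apply, innerSL_apply_apply, smul_eq_mul]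
  ring

theorem genFunk_eq (e : EuclideanSpace ℝ (Fin n)) :
    genFunk e = randersDeform (randers (-(-1 / 2))) (bBar (-1 / 2) e 1) := by
  ext z
  rw [genFunk, randersDeform, ofForm, bBar_half, randers_half_eq_funk]

theorem one_add_inner_pos {e x : EuclideanSpace ℝ (Fin n)} (he : ‖e‖ < 1) (hx : ‖x‖ < 1) :
    0 < 1 + inner ℝ e x := by
  have h := abs_le.1 (abs_real_inner_le_norm e x)
  have : ‖e‖ * ‖x‖ < 1 := by nlinarith [norm_nonneg e, norm_nonneg x]
  linarith [h.1]

/-- Here `F = ‖y + Fx‖`, so `(1 + ⟨e,x⟩)F + ⟨e,y⟩ = F + ⟨e, y + Fx⟩ ≥ (1 - ‖e‖)F > 0`. -/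
theorem genFunk_pos {e : EuclideanSpace ℝ (Fin n)} (he : ‖e‖ < 1)
    {z : EuclideanSpace ℝ (Fin n) × EuclideanSpace ℝ (Fin n)} (hz : z ∈ slit (ball 0 1)) :
    0 < genFunk e z := by
  have hw : ∀ x ∈ ball (0 : EuclideanSpace ℝ (Fin n)) 1,
      0 < 1 - 4 * (-(-1 / 2) : ℝ) ^ 2 * ‖x‖ ^ 2 := fun x hx =>
    one_sub_norm_sq_pos_of_subset_ball (U := ball 0 1) (by norm_num)
      (by rw [abs_of_pos (by norm_num)]; norm_num) hx
  have hF := isFunkRoot_randers hw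
  have hpos := hF.pos z hz
  have hsq := hF.sq_eq z hz
  have h1 := one_add_inner_pos he (mem_ball_zero_iff.1 hz.1)
  rw [genFunk_eq, randersDeform]
  set F := randers (-(-1 / 2)) z
  rw [show (2 : ℝ) * (-(-1 / 2)) * F = F by ring] at hsq
  have hnorm : F = ‖z.2 + F • z.1‖ := (sq_eq_sq₀ hpos.le (norm_nonneg _)).1 hsq
  have h2 : 0 < (1 + inner ℝ e z.1) * F + inner ℝ e z.2 := by
    have h3 := (abs_le.1 (abs_real_inner_le_norm e (z.2 + F • z.1))).1
    rw [← hnorm, inner_add_right, real_inner_smul_right] at h3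
    have : ‖e‖ * F < 1 * F := mul_lt_mul_of_pos_right he hpos
    linarith
  rw [ofForm, bBar_half]
  have : F + inner ℝ e z.2 / (1 + inner ℝ e z.1) =
      ((1 + inner ℝ e z.1) * F + inner ℝ e z.2) / (1 + inner ℝ e z.1) := by
    field_simp
  rw [this]
  positivity

theorem isFinsler_and_curvature_randersDeform (hU : IsOpen U) (hν : ν ≠ 0)
    (hUb : U ⊆ ball 0 (1 / (2 * |ν|))) (e : EuclideanSpace ℝ (Fin n)) (f : ℝ)
    (hef : ∀ x ∈ U, inner ℝ e x + f ≠ 0)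
    (hpos : ∀ z ∈ slit U, 0 < randersDeform (randers (-ν)) (bBar ν e f) z) :
    IsFinsler U (randersDeform (randers (-ν)) (bBar ν e f)) ∧
      HasConstFlagCurv U (randersDeform (randers (-ν)) (bBar ν e f)) (-(ν ^ 2)) := by
  have hw : ∀ x ∈ U, 0 < 1 - 4 * (-ν) ^ 2 * ‖x‖ ^ 2 := fun x hx => by
    rw [neg_sq]
    exact one_sub_norm_sq_pos_of_subset_ball hν hUb hx
  have hF := isFunkRoot_randers hw
  have hb : IsFunk U (- -ν) (ofForm (bBar ν e f)) := by
    rw [neg_neg]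
    exact isFunk_bBar hU hν hef
  refine ⟨hF.isFinsler_randersDeform hU (continuousOn_randers hw)
    (fun x _ y t ht => randers_smul x y ht) (contDiffOn_bBar hν hef) hpos, ?_⟩
  rw [← neg_sq ν]
  exact (hF.isFunk hU).hasConstFlagCurv_add hU hb

end Randers

end FinslerDeform

/-! ### Assembly of the four statements -/

theorem mainTheorem10 (n : ℕ) (ν : ℝ) (hν : ν ≠ 0) (U : Set (EuclideanSpace ℝ (Fin n)))
    (hUo : IsOpen U) (hUc : Convex ℝ U) (hUb : U ⊆ Metric.ball 0 (1 / (2 * |ν|))) :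
    -- the initial metric
    (IsFinsler U (randers (-ν)) ∧
      ProjFlat U (randers (-ν)) (fun z => -ν * randers (-ν) z) ∧
      HasConstFlagCurv U (randers (-ν)) (-(ν ^ 2))) ∧
    -- the deformed metrics
    (∀ (e : EuclideanSpace ℝ (Fin n)) (f : ℝ),
      (∀ x ∈ U, inner ℝ e x + f ≠ 0) →
      (∀ z ∈ slit U, 0 < randersDeform (randers (-ν)) (bBar ν e f) z) →
      IsFinsler U (randersDeform (randers (-ν)) (bBar ν e f)) ∧
      ProjRelated U (randers (-ν)) (randersDeform (randers (-ν)) (bBar ν e f))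
        (fun z => ν * ofForm (bBar ν e f) z) ∧
      (∀ S, IsGeodesicSpray U (randers (-ν)) S →
        IsHamel U S (fun z => ν * ofForm (bBar ν e f) z)) ∧
      ProjFlat U (randersDeform (randers (-ν)) (bBar ν e f))
        (fun z => -ν * (randers (-ν) z - ofForm (bBar ν e f) z)) ∧
      HasConstFlagCurv U (randersDeform (randers (-ν)) (bBar ν e f)) (-(ν ^ 2))) ∧
    -- no other Randers deformation has a projective factor proportional to its 1-form
    (∀ (μ : ℝ) (β : EuclideanSpace ℝ (Fin n) → (EuclideanSpace ℝ (Fin n) →L[ℝ] ℝ)),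
      ContDiffOn ℝ ∞ β U → (∃ x ∈ U, β x ≠ 0) →
      IsFinsler U (randersDeform (randers (-ν)) β) →
      ProjRelated U (randers (-ν)) (randersDeform (randers (-ν)) β)
        (fun z => μ * ofForm β z) →
      μ = ν ∧ ∃ (e : EuclideanSpace ℝ (Fin n)) (f : ℝ),
        ∀ x ∈ U, inner ℝ e x + f ≠ 0 ∧ β x = bBar ν e f x) ∧
    -- the Funk metric and the generalized Funk metric
    (∀ e : EuclideanSpace ℝ (Fin n), ‖e‖ < 1 →
      (∀ x ∈ Metric.ball (0 : EuclideanSpace ℝ (Fin n)) 1, inner ℝ e x + 1 ≠ 0) ∧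
      (∀ x ∈ Metric.ball (0 : EuclideanSpace ℝ (Fin n)) 1, ∀ y : EuclideanSpace ℝ (Fin n),
        randers (-(-1 / 2)) (x, y) = funk (x, y) ∧
        randersDeform (randers (-(-1 / 2))) (bBar (-1 / 2) e 1) (x, y) = genFunk e (x, y)) ∧
      IsFinsler (Metric.ball 0 1) (genFunk e) ∧
      HasConstFlagCurv (Metric.ball 0 1) (genFunk e) (-1 / 4)) := by
  have hw : ∀ x ∈ U, 0 < 1 - 4 * (-ν) ^ 2 * ‖x‖ ^ 2 := fun x hx => by
    rw [neg_sq]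
    exact one_sub_norm_sq_pos_of_subset_ball hν hUb hx
  have hroot := isFunkRoot_randers hw
  have hF := hroot.isFunk hUo
  have hFinsler : IsFinsler U (randers (-ν)) := by
    have h0 : randersDeform (randers (-ν)) (fun _ => 0) =
        (randers (-ν) : EuclideanSpace ℝ (Fin n) × EuclideanSpace ℝ (Fin n) → ℝ) := by
      ext z
      simp [randersDeform, ofForm]
    have h := hroot.isFinsler_randersDeform (β := fun _ => 0) hUo (continuousOn_randers hw)
      (fun x _ y t ht => randers_smul x y ht) contDiffOn_const (by rw [h0]; exact hroot.pos)
    rwa [h0] at h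
  refine ⟨⟨hFinsler, hF.projFlat hUo, ?_⟩, ?_, ?_, ?_⟩
  · rw [← neg_sq ν]
    exact hF.hasConstFlagCurv hUo
  · intro e f hef hpos
    have hb := isFunk_bBar hUo hν hef
    have hb' : IsFunk U (- -ν) (ofForm (bBar ν e f)) := by rwa [neg_neg]
    obtain ⟨h1, h2⟩ := isFinsler_and_curvature_randersDeform hUo hν hUb e f hef hpos
    refine ⟨h1, ?_, ?_, hF.projFlat_add hUo hb', h2⟩
    · have h := hF.projRelated_add hUo hb'
      rwa [neg_neg] at h
    · intro S hS
      exact hb.isHamel_const_mul hUo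
        (fun z hz => hFinsler.geodesicSpray_unique hUo hS (hF.isGeodesicSpray hUo) hz) ν
  · rintro μ β hβ hβ0 hFβ ⟨S, S', hS, hS', -, hrel⟩
    -- Uniqueness of the geodesic spray replaces the given `S` by the explicit `S₀ + 2νF𝒞`.
    have hS'Q : ∀ z ∈ slit U,
        S' z = sprayOf (fun w => -ν * randers (-ν) w + μ * ofForm β w) z := by
      intro z hz
      rw [hrel z hz, hFinsler.geodesicSpray_unique hUo hS (hF.isGeodesicSpray hUo) hz]
      simp only [sprayOf]
      module
    have hμ := factor_eq_of_projRelated hUo hF hroot.pos hβ hβ0 hFβ hS' hS'Q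
    subst hμ
    refine ⟨neg_neg ν, exists_eq_bBar_of_fderiv hUo hUc hν hβ hβ0 fun x hx u v => ?_⟩
    have h := fderiv_form_of_projRelated hUo hF hβ hFβ hS' hS'Q hx u v
    rwa [neg_neg] at h
  · intro e he
    have hball : ball (0 : EuclideanSpace ℝ (Fin n)) 1 ⊆ ball 0 (1 / (2 * |(-1 / 2 : ℝ)|)) := by
      rw [abs_of_neg (by norm_num)]
      norm_num
    have hne : ∀ x ∈ ball (0 : EuclideanSpace ℝ (Fin n)) 1, inner ℝ e x + 1 ≠ 0 := by
      intro x hx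
      rw [add_comm]
      exact (one_add_inner_pos he (mem_ball_zero_iff.1 hx)).ne'
    have hfunk := genFunk_eq e
    obtain ⟨h1, h2⟩ := isFinsler_and_curvature_randersDeform isOpen_ball
      (by norm_num : (-1 / 2 : ℝ) ≠ 0) hball e 1 hne (by
        rw [← hfunk]
        exact fun z hz => genFunk_pos he hz)
    rw [← hfunk] at h1 h2
    refine ⟨hne, fun x _ y => ⟨congrFun randers_half_eq_funk (x, y), by rw [hfunk]⟩, h1, ?_⟩
    convert h2 using 1
    norm_num
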